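/- Let $q,r\ge 1$ be integers. On the semi-infinite wedge space over $\mathbb C$, with basis the products $k_1\wedge k_2\wedge\cdots$ of half-integers $k_1>k_2>\cdots$ that contain all but finitely many negative and only finitely many positive half-integers, let $\psi_k$ be wedging by $k$ from the left, $\psi_k^*$ its adjoint, $E_{i,j}=\psi_i\psi_j^*$ for $j>0$ and $E_{i,j}=-\psi_j^*\psi_i$ for $j<0$, and put $$\alpha_m=\sum_{k\in\mathbb Z+1/2}E_{k-m,k},\qquad \mathcal F_m=\sum_{k\in\mathbb Z+1/2}k^mE_{k,k}.$$ Let $\langle\,\cdot\,\rangle$ be the expectation value in the vacuum $-\tfrac12\wedge-\tfrac32\wedge\cdots$. For $\mu=(\mu_1,\dots,\mu_n)$ with $\mu_i\ge 1$ and $|\mu|=\sum_i\mu_i$, the disconnected $r$-spin $q$-orbifold Hurwitz number with $b\ge 0$ completed $(r+1)$-cycles is $$h^{\bullet}_{\mu,b}=\Big\langle \frac{\alpha_q^{|\mu|/q}}{q^{|\mu|/q}(|\mu|/q)!}\,\frac{\mathcal F_{r+1}^b}{(r+1)^b}\prod_{i=1}^n\frac{\alpha_{-\mu_i}}{\mu_i}\Big\rangle$$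 if $q$ divides $|\mu|$, and $0$ otherwise. The connected numbers $h^\circ_{\mu,b}$ ($n\ge1$) are obtained by inclusion-exclusion, $$\sum_{b\ge0} h^\circ_{\mu,b}\frac{\beta^b}{b!}=\sum_{\pi}(-1)^{|\pi|-1}(|\pi|-1)!\prod_{B\in\pi}\Big(\sum_{b\ge0} h^\bullet_{\mu_B,b}\frac{\beta^b}{b!}\Big),$$ where $\pi$ runs over the set partitions of $\{1,\dots,n\}$ and $\mu_B=(\mu_i)_{i\in B}$. For $g\ge0$ put $h^\circ_{g;\mu}=h^\circ_{\mu,b}$ with $b=\frac{(2g-2+n)q+|\mu|}{qr}$ if this is a non-negative integer, and $h^\circ_{g;\mu}=0$ otherwise. Let $$H_{g,n}(x_1,\dots,x_n)=\sum_{\mu_1,\dots,\mu_n\ge1}\frac{h^\circ_{g;\mu}}{b!}\,\frac1{n!}\sum_{\sigma\in\mathfrak S_n}\prod_{i=1}^n x_i^{\mu_{\sigma(i)}}.$$ **Lemma.** Let $y(x)=x\,\partial_xH_{0,1}(x)\in\mathbb C[[x]]$. 1. There is exactly one power series $z(x)=y(x)^{1/q}$ with $z(x)^q=y(x)$ in which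 the coefficient of $x$ is $1$, and it satisfies $$x=y(x)^{1/q}\,e^{-y(x)^r}\quad\text{in }\mathbb C[[x]].$$ 2. $y(x)$ is the expansion at $x=0$ of the function $y$ on the spectral curve $x(z)=z\,e^{-z^{qr}}$, $y(z)=z^q$: there is $\delta>0$ such that for all $z\in\mathbb C$ with $|z|<\delta$ the series $y(x)$ converges at $x=z\,e^{-z^{qr}}$, with sum $z^q$. -/

import Mathlib

noncomputable section

namespace SpinHurwitz

/-- A basis state `k₁ ∧ k₂ ∧ ⋯` (with `k₁ > k₂ > ⋯`) of the semi-infinite wedge space, recorded as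
the set of its factors. The integer `k` stands for the half-integer `k + 1/2`, so the site `k` is
positive if `0 ≤ k` and negative if `k < 0`. All but finitely many negative sites are occupied, and
only finitely many positive ones are. -/
structure State where
  occ : Set ℤ
  finite_particles : {k | 0 ≤ k ∧ k ∈ occ}.Finite
  finite_holes : {k | k < 0 ∧ k ∉ occ}.Finite

namespace State

/-- The vacuum `(-1/2) ∧ (-3/2) ∧ (-5/2) ∧ ⋯`. -/
def vacuum : State where
  occ := {k | k < 0}
  finite_particles := by
    convert Set.finite_empty (α := ℤ)
    ext k; simp
  finite_holes := by
    convert Set.finite_empty (α := ℤ)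
    ext k; simp

/-- Occupy the site `k`. -/
def insert (k : ℤ) (S : State) : State where
  occ := Insert.insert k S.occ
  finite_particles := (S.finite_particles.insert k).subset (by
    rintro j ⟨h0, rfl | hj⟩
    · simp
    · exact Or.inr ⟨h0, hj⟩)
  finite_holes := S.finite_holes.subset (by
    rintro j ⟨h0, hj⟩
    exact ⟨h0, fun h => hj (Or.inr h)⟩)

/-- Empty the site `k`. -/
def erase (k : ℤ) (S : State) : State where
  occ := S.occ \ {k}
  finite_particles := S.finite_particles.subset (by
    rintro j ⟨h0, hj⟩
    exact ⟨h0, hj.1⟩)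
  finite_holes := (S.finite_holes.insert k).subset (by
    rintro j ⟨h0, hj⟩
    by_cases h : j = k
    · exact Or.inl h
    · exact Or.inr ⟨h0, fun h' => hj ⟨h', h⟩⟩)

/-- The sign `(-1)^m`, with `m` the (finite) number of occupied sites above `k`: it moves a factor
between the front of the wedge product and its place in decreasing order. -/
def sign (k : ℤ) (S : State) : ℂ := (-1) ^ {j | k < j ∧ j ∈ S.occ}.ncard

end State

/-- The semi-infinite wedge space (of all charges): finite linear combinations of states. -/
abbrev Fock : Type := State →₀ ℂ

open Classical in
/-- `ψ_k`: wedging with `k` from the left. -/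
def psi (k : ℤ) : Module.End ℂ Fock :=
  Finsupp.linearCombination ℂ fun S : State =>
    if k ∈ S.occ then (0 : Fock) else Finsupp.single (S.insert k) (S.sign k)

open Classical in
/-- `ψ_k^*`: the adjoint of `ψ_k`, contraction with `k`. -/
def psiStar (k : ℤ) : Module.End ℂ Fock :=
  Finsupp.linearCombination ℂ fun S : State =>
    if k ∈ S.occ then Finsupp.single (S.erase k) (S.sign k) else (0 : Fock)

/-- The normally ordered product `E_{i,j} = :ψ_i ψ_j^*:`. -/
def elem (i j : ℤ) : Module.End ℂ Fock :=
  if 0 ≤ j then psi i * psiStar j else -(psiStar j * psi i)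

/-- `α_m = ∑_k E_{k-m,k}`. On each basis state only finitely many terms are nonzero. -/
def alpha (m : ℤ) : Module.End ℂ Fock :=
  Finsupp.linearCombination ℂ fun S : State =>
    ∑ᶠ k : ℤ, elem (k - m) k (Finsupp.single S 1)

/-- `F_m = ∑_k (k + 1/2)^m E_{k,k}`: up to the factor `1/m`, multiplication by the completed
`m`-cycle. On each basis state only finitely many terms are nonzero. -/
def completedCycle (m : ℕ) : Module.End ℂ Fock :=
  Finsupp.linearCombination ℂ fun S : State =>
    ∑ᶠ k : ℤ, ((k : ℂ) + 1 / 2) ^ m • elem k k (Finsupp.single S 1)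

/-- The vacuum expectation value of an operator. -/
def vev (A : Module.End ℂ Fock) : ℂ := A (Finsupp.single State.vacuum 1) State.vacuum

/-- The disconnected `r`-spin `q`-orbifold Hurwitz number of `μ` with `b` completed
`(r+1)`-cycles. It vanishes unless `q` divides `|μ|`. -/
def disconnected (q r : ℕ) (μ : List ℕ) (b : ℕ) : ℂ :=
  if q ∣ μ.sum then
    vev (((q : ℂ) ^ (μ.sum / q) * ((μ.sum / q).factorial : ℂ))⁻¹ • alpha q ^ (μ.sum / q)
      * ((r + 1 : ℂ) ^ b)⁻¹ • completedCycle (r + 1) ^ b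
      * (μ.map fun m : ℕ => (m : ℂ)⁻¹ • alpha (-(m : ℤ))).prod)
  else 0

/-- `∑_b (disconnected number with b completed cycles) β^b / b!`. -/
def disconnectedSeries (q r : ℕ) (μ : List ℕ) : PowerSeries ℂ :=
  PowerSeries.mk fun b => disconnected q r μ b / (b.factorial : ℂ)

open Classical in
/-- `∑_b (connected number with b completed cycles) β^b / b!` for a tuple of length `n ≥ 1`,
by inclusion-exclusion: the parts of the covering labelled by the blocks of a set partition `π` of
the entries of `μ` are split off, with Möbius coefficient `(-1)^(|π|-1) (|π|-1)!`. -/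
def connectedSeries (q r : ℕ) {n : ℕ} (μ : Fin n → ℕ) : PowerSeries ℂ :=
  ∑ π : Finpartition (Finset.univ : Finset (Fin n)),
    PowerSeries.C ((-1) ^ (π.parts.card - 1) * ((π.parts.card - 1).factorial : ℂ)) *
      ∏ B ∈ π.parts, disconnectedSeries q r ((B.sort (· ≤ ·)).map μ)

/-- The number `b = ((2g - 2 + n) q + |μ|) / (q r)` of completed cycles in genus `g`. -/
def branchNumber (q r g : ℕ) {n : ℕ} (μ : Fin n → ℕ) : ℚ :=
  ((2 * (g : ℚ) - 2 + n) * q + ∑ i, (μ i : ℚ)) / (q * r)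

open Classical in
/-- The connected `r`-spin `q`-orbifold Hurwitz number `h^∘_{g;μ}`; it is zero unless `b` is a
non-negative integer. -/
def connected (q r g : ℕ) {n : ℕ} (μ : Fin n → ℕ) : ℂ :=
  if (⌊branchNumber q r g μ⌋₊ : ℚ) = branchNumber q r g μ then
    (⌊branchNumber q r g μ⌋₊.factorial : ℂ) *
      PowerSeries.coeff ⌊branchNumber q r g μ⌋₊ (connectedSeries q r μ)
  else 0

open Classical in
/-- The correlator `H_{g,n}` in the variables `x_i`, `i ∈ ι`, where `n = |ι| ≥ 1`: the series
`∑_{μ₁,…,μₙ ≥ 1} (h^∘_{g;μ} / b!) M_μ(x)`, where `M_μ` is the average of the monomials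
`∏ x_{σ i}^{μ_i}` over the `n!` bijections `σ` from the positions to the variables. -/
def correlator (q r g : ℕ) (ι : Type) [Fintype ι] : MvPowerSeries ι ℂ := fun ν =>
  ((Fintype.card ι).factorial : ℂ)⁻¹ * ∑ σ : Fin (Fintype.card ι) ≃ ι,
    if ∀ i, 0 < ν i then
      connected q r g (fun j => ν (σ j)) /
        (⌊branchNumber q r g (fun j => ν (σ j))⌋₊.factorial : ℂ)
    else 0

/-- `H_{0,1}(x)`, a power series in one variable. -/
def H01 (q r : ℕ) : PowerSeries ℂ := correlator q r 0 Unit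

/-- `y(x) = x ∂_x H_{0,1}(x)`. -/
def y (q r : ℕ) : PowerSeries ℂ := PowerSeries.X * PowerSeries.derivative ℂ (H01 q r)

end SpinHurwitz

end

/-! The point is an explicit formula: `y` is the sum over `b` of `c_b x^n` with `n = q(rb+1)` and
`c_b = q n^(b-1) / b!`. For genus 0 and one part, the Riemann-Hurwitz count leaves only these
exponents, and connected and disconnected numbers agree. Applied to the vacuum, `α_{-n}` gives a sum
of vectors with one particle and one hole; the completed cycle is diagonal on them, with an
eigenvalue polynomial of degree `r` in the hole position, and `α_q` acts as a backward difference
with step `q`. So the expectation is an `rb`-fold difference of a polynomial of degree at most `rb`,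
which sees only its top coefficient (`alpha_pow_hookSum`, `iterate_sub_shift_eval`, `vev_one_part`).

Substituting `x = z e^{-z^(qr)}`, the coefficient of `z^(q(rs+1))` is, for `s > 0`, an `s`-th
difference of a polynomial of degree `s-1`, hence zero (`sum_yCoeff_mul`). Thus `y(x(z)) = z^q`.
Formally, the compositional inverse of `x(z)` is the required root; analytically, the same
rearrangement is justified by absolute convergence for `|z| < e^{-2}`. -/

noncomputable section

namespace SpinHurwitz

/-! ### Occupied sites and signs -/

namespace State

theorem ext_occ {S T : State} (h : S.occ = T.occ) : S = T := by
  cases S; cases T; simpa using h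

theorem finite_above (k : ℤ) (S : State) : {j | k < j ∧ j ∈ S.occ}.Finite := by
  refine (S.finite_particles.union (Set.finite_Ioo k 0)).subset ?_
  rintro j ⟨h1, h2⟩
  by_cases h : 0 ≤ j
  · exact Or.inl ⟨h, h2⟩
  · exact Or.inr ⟨h1, by simpa using h⟩

@[simp] theorem mem_insert {i j : ℤ} {S : State} : i ∈ (S.insert j).occ ↔ i = j ∨ i ∈ S.occ :=
  Iff.rfl

@[simp] theorem mem_erase {i j : ℤ} {S : State} : i ∈ (S.erase j).occ ↔ i ∈ S.occ ∧ i ≠ j :=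
  Iff.rfl

@[simp] theorem mem_vacuum {i : ℤ} : i ∈ vacuum.occ ↔ i < 0 := Iff.rfl

theorem sign_insert (k : ℤ) {j : ℤ} {S : State} (hj : j ∉ S.occ) :
    (S.insert j).sign k = if k < j then -S.sign k else S.sign k := by
  unfold sign
  split_ifs with h
  · have : {i | k < i ∧ i ∈ (S.insert j).occ} = Insert.insert j {i | k < i ∧ i ∈ S.occ} := by
      ext i
      simp only [mem_insert, Set.mem_ofPred_eq, Set.mem_insert_iff]
      grind
    rw [this, Set.ncard_insert_of_notMem (fun h => hj h.2) (finite_above k S), pow_succ]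
    ring
  · congr 2
    ext i
    simp only [mem_insert, Set.mem_ofPred_eq]
    grind

theorem insert_erase {j : ℤ} {S : State} (hj : j ∈ S.occ) : (S.erase j).insert j = S :=
  ext_occ (by ext i; simp only [mem_insert, mem_erase]; grind)

theorem erase_insert {j : ℤ} {S : State} (hj : j ∉ S.occ) : (S.insert j).erase j = S :=
  ext_occ (by ext i; simp only [mem_insert, mem_erase]; grind)

theorem insert_comm (i j : ℤ) (S : State) : (S.insert i).insert j = (S.insert j).insert i :=
  ext_occ (by ext k; simp only [mem_insert]; grind)

theorem insert_erase_comm {i j : ℤ} (h : i ≠ j) (S : State) :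
    (S.erase j).insert i = (S.insert i).erase j :=
  ext_occ (by ext k; simp only [mem_insert, mem_erase]; grind)

theorem sign_erase (k : ℤ) {j : ℤ} {S : State} (hj : j ∈ S.occ) :
    (S.erase j).sign k = if k < j then -S.sign k else S.sign k := by
  have h := sign_insert k (j := j) (S := S.erase j) (by simp)
  rw [insert_erase hj] at h
  split_ifs at h ⊢ <;> rw [h]
  rw [neg_neg]

theorem sign_mul_self (k : ℤ) (S : State) : S.sign k * S.sign k = 1 := by
  unfold sign
  rw [← mul_pow]
  simp

end State

/-! ### Anticommutation relations and the operators on basis states -/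

open State

/-- The basis vector of a state. -/
def ket (S : State) : Fock := Finsupp.single S 1

theorem end_ext {A B : Module.End ℂ Fock} (h : ∀ S, A (ket S) = B (ket S)) : A = B :=
  Finsupp.lhom_ext' fun S => LinearMap.ext_ring (h S)

open Classical in
theorem psi_ket (k : ℤ) (S : State) :
    psi k (ket S) = if k ∈ S.occ then 0 else S.sign k • ket (S.insert k) := by
  simp [psi, ket]

open Classical in
theorem psiStar_ket (k : ℤ) (S : State) :
    psiStar k (ket S) = if k ∈ S.occ then S.sign k • ket (S.erase k) else 0 := by
  simp [psiStar, ket]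

theorem psi_ket_of_mem {k : ℤ} {S : State} (h : k ∈ S.occ) : psi k (ket S) = 0 := by
  rw [psi_ket, if_pos h]

theorem psi_ket_of_notMem {k : ℤ} {S : State} (h : k ∉ S.occ) :
    psi k (ket S) = S.sign k • ket (S.insert k) := by
  rw [psi_ket, if_neg h]

theorem psiStar_ket_of_mem {k : ℤ} {S : State} (h : k ∈ S.occ) :
    psiStar k (ket S) = S.sign k • ket (S.erase k) := by
  rw [psiStar_ket, if_pos h]

theorem psiStar_ket_of_notMem {k : ℤ} {S : State} (h : k ∉ S.occ) : psiStar k (ket S) = 0 := by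
  rw [psiStar_ket, if_neg h]

theorem psi_mul_psi (i j : ℤ) : psi i * psi j = -(psi j * psi i) := by
  refine end_ext fun S => ?_
  simp only [Module.End.mul_apply, LinearMap.neg_apply]
  by_cases hi : i ∈ S.occ
  · rw [psi_ket_of_mem hi, map_zero, neg_zero]
    by_cases hj : j ∈ S.occ
    · rw [psi_ket_of_mem hj, map_zero]
    · rw [psi_ket_of_notMem hj, map_smul, psi_ket_of_mem (Or.inr hi), smul_zero]
  by_cases hj : j ∈ S.occ
  · rw [psi_ket_of_mem hj, map_zero, psi_ket_of_notMem hi, map_smul, psi_ket_of_mem (Or.inr hj),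
      smul_zero, neg_zero]
  rw [psi_ket_of_notMem hi, psi_ket_of_notMem hj, map_smul, map_smul]
  by_cases hij : i = j
  · subst hij
    rw [psi_ket_of_mem (Or.inl rfl), smul_zero, neg_zero]
  rw [psi_ket_of_notMem (by simp [hi, hij]), psi_ket_of_notMem (by simp [hj, Ne.symm hij]),
    sign_insert _ hi, sign_insert _ hj, insert_comm, smul_smul, smul_smul, ← neg_smul]
  congr 1
  rcases lt_or_gt_of_ne hij with h | h
  · rw [if_pos h, if_neg h.not_gt]; ring
  · rw [if_pos h, if_neg h.not_gt]; ring

theorem psi_mul_psiStar {i j : ℤ} (hij : i ≠ j) : psi i * psiStar j = -(psiStar j * psi i) := by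
  refine end_ext fun S => ?_
  simp only [Module.End.mul_apply, LinearMap.neg_apply]
  by_cases hi : i ∈ S.occ
  · rw [psi_ket_of_mem hi, map_zero, neg_zero]
    by_cases hj : j ∈ S.occ
    · rw [psiStar_ket_of_mem hj, map_smul, psi_ket_of_mem (by simp [hi, hij]), smul_zero]
    · rw [psiStar_ket_of_notMem hj, map_zero]
  by_cases hj : j ∈ S.occ
  swap
  · rw [psiStar_ket_of_notMem hj, map_zero, psi_ket_of_notMem hi, map_smul,
      psiStar_ket_of_notMem (by simp [hj, Ne.symm hij]), smul_zero, neg_zero]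
  rw [psi_ket_of_notMem hi, psiStar_ket_of_mem hj, map_smul, map_smul,
    psi_ket_of_notMem (by simp [hi]), psiStar_ket_of_mem (Or.inr hj),
    sign_insert _ hi, sign_erase _ hj, insert_erase_comm hij, smul_smul, smul_smul, ← neg_smul]
  congr 1
  rcases lt_or_gt_of_ne hij with h | h
  · rw [if_pos h, if_neg h.not_gt]; ring
  · rw [if_pos h, if_neg h.not_gt]; ring

theorem psi_psiStar_ket_of_mem {k : ℤ} {S : State} (h : k ∈ S.occ) :
    psi k (psiStar k (ket S)) = ket S := by
  rw [psiStar_ket_of_mem h, map_smul, psi_ket_of_notMem (by simp), insert_erase h,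
    sign_erase _ h, if_neg (lt_irrefl k), smul_smul, sign_mul_self, one_smul]

theorem psiStar_psi_ket_of_notMem {k : ℤ} {S : State} (h : k ∉ S.occ) :
    psiStar k (psi k (ket S)) = ket S := by
  rw [psi_ket_of_notMem h, map_smul, psiStar_ket_of_mem (Or.inl rfl), erase_insert h,
    sign_insert _ h, if_neg (lt_irrefl k), smul_smul, sign_mul_self, one_smul]

theorem elem_of_ne {i j : ℤ} (h : i ≠ j) : elem i j = psi i * psiStar j := by
  unfold elem
  split_ifs
  · rfl
  · rw [psi_mul_psiStar h]

theorem elem_ket_eq_zero {i j : ℤ} (hij : i ≠ j) {S : State} (h : j ∈ S.occ → i ∈ S.occ) :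
    elem i j (ket S) = 0 := by
  rw [elem_of_ne hij, Module.End.mul_apply]
  by_cases hj : j ∈ S.occ
  · rw [psiStar_ket_of_mem hj, map_smul, psi_ket_of_mem (by simp [h hj, hij]), smul_zero]
  · rw [psiStar_ket_of_notMem hj, map_zero]

/-- Normal ordering measures occupation relative to the vacuum: a particle counts 1, a hole -1, any
other site 0. -/
theorem elem_self_ket {k : ℤ} {S : State} {c : ℂ}
    (hpos : 0 ≤ k → k ∈ S.occ → c = 1) (hpos' : 0 ≤ k → k ∉ S.occ → c = 0)
    (hneg : k < 0 → k ∈ S.occ → c = 0) (hneg' : k < 0 → k ∉ S.occ → c = -1) :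
    elem k k (ket S) = c • ket S := by
  unfold elem
  by_cases hk : k ∈ S.occ <;> split_ifs with h0
  · rw [Module.End.mul_apply, psi_psiStar_ket_of_mem hk, hpos h0 hk, one_smul]
  · rw [LinearMap.neg_apply, Module.End.mul_apply, psi_ket_of_mem hk, hneg (by lia) hk]
    simp
  · rw [Module.End.mul_apply, psiStar_ket_of_notMem hk, hpos' h0 hk]
    simp
  · rw [LinearMap.neg_apply, Module.End.mul_apply, psiStar_psi_ket_of_notMem hk,
      hneg' (by lia) hk, neg_one_smul]

/-- Moving `k` to `k - m` gives zero unless `k` is occupied and the target empty, so any finite set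
containing such `k` suffices. -/
theorem alpha_ket {m : ℤ} (hm : m ≠ 0) {S : State} {K : Finset ℤ}
    (hK : ∀ k ∈ S.occ, k - m ∉ S.occ → k ∈ K) :
    alpha m (ket S) = ∑ k ∈ K, elem (k - m) k (ket S) := by
  have : alpha m (ket S) = ∑ᶠ k : ℤ, elem (k - m) k (ket S) := by simp [alpha, ket]
  rw [this]
  refine finsum_eq_sum_of_support_subset _ fun k hk => ?_
  by_contra hkK
  refine hk (elem_ket_eq_zero (by simpa using hm) fun h => ?_)
  by_contra h'
  exact hkK (hK k h h')

/-! ### One particle and one hole -/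

/-- The vacuum vector. -/
def vac : Fock := ket vacuum

/-- The vacuum with its factor `h` moved to the site `p`. -/
def hook (p h : ℤ) : Fock := psi p (psiStar h vac)

theorem hook_of_nonneg (p : ℤ) {h : ℤ} (hh : 0 ≤ h) : hook p h = 0 := by
  rw [hook, vac, psiStar_ket_of_notMem (by simpa using hh), map_zero]

theorem hook_self {h : ℤ} (hh : h < 0) : hook h h = vac := psi_psiStar_ket_of_mem hh

theorem hook_of_neg {p h : ℤ} (hp : p < 0) (hph : p ≠ h) : hook p h = 0 := by
  by_cases hh : h < 0
  · rw [hook, vac, psiStar_ket_of_mem hh, map_smul, psi_ket_of_mem (by simp [hp, hph]), smul_zero]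
  · exact hook_of_nonneg p (by lia)

theorem hook_eq_smul_ket {p h : ℤ} (hp : 0 ≤ p) (hh : h < 0) :
    ∃ c : ℂ, hook p h = c • ket ((vacuum.erase h).insert p) := by
  rw [hook, vac, psiStar_ket_of_mem hh, map_smul, psi_ket_of_notMem (by simp [hp]), smul_smul]
  exact ⟨_, rfl⟩

/-- The particle moves down or the hole moves up. Degenerate values of `hook` (zero, or the vacuum
when the particle fills its hole) keep the formula uniform. -/
theorem alpha_hook {q p h : ℤ} (hq : 0 < q) (hp : 0 ≤ p) (hh : h < 0) :
    alpha q (hook p h) = hook (p - q) h - hook p (h + q) := by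
  -- Only the particle can move, or the factor `q` above the hole can drop into it; the two sites
  -- may coincide.
  have key : alpha q (hook p h) = ∑ k ∈ {p, h + q}, elem (k - q) k (hook p h) := by
    obtain ⟨c, hc⟩ := hook_eq_smul_ket hp hh
    simp only [hc, map_smul]
    rw [alpha_ket (K := {p, h + q}) hq.ne', Finset.smul_sum]
    intro k
    simp only [mem_insert, mem_erase, mem_vacuum, Finset.mem_insert, Finset.mem_singleton]
    lia
  have hfirst : elem (p - q) p (hook p h) = hook (p - q) h := by
    have : psiStar p (hook p h) = psiStar h vac := by
      rw [hook, vac, psiStar_ket_of_mem hh, map_smul, map_smul,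
        psiStar_psi_ket_of_notMem (by simp [hp])]
    rw [elem_of_ne (by lia), Module.End.mul_apply, this, hook]
  rw [key]
  by_cases hpq : p = h + q
  · rw [← hpq, Finset.pair_eq_singleton, Finset.sum_singleton, hfirst,
      hook_of_nonneg p hp, sub_zero]
  rw [Finset.sum_pair hpq, hfirst, sub_eq_add_neg]
  have e1 : ∀ v, psi h (psiStar (h + q) v) = -psiStar (h + q) (psi h v) := fun v =>
    LinearMap.congr_fun (psi_mul_psiStar (i := h) (j := h + q) (by lia)) v
  have e2 : ∀ v, psi h (psi p v) = -psi p (psi h v) := fun v =>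
    LinearMap.congr_fun (psi_mul_psi h p) v
  have e3 : ∀ v, psi p (psiStar (h + q) v) = -psiStar (h + q) (psi p v) := fun v =>
    LinearMap.congr_fun (psi_mul_psiStar hpq) v
  rw [elem_of_ne (by lia), Module.End.mul_apply, add_sub_cancel_right, hook.eq_def p h, e1, e2,
    show psi h (psiStar h vac) = vac from hook_self hh, hook.eq_def p (h + q), e3]
  simp

theorem completedCycle_hook (m : ℕ) {p h : ℤ} (hp : 0 ≤ p) (hh : h < 0) :
    completedCycle m (hook p h)
      = (((p : ℂ) + 1 / 2) ^ m - ((h : ℂ) + 1 / 2) ^ m) • hook p h := by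
  obtain ⟨c, hc⟩ := hook_eq_smul_ket hp hh
  rw [hc, map_smul, smul_comm]
  congr 1
  set S := (vacuum.erase h).insert p with hS
  have hmem : ∀ k, k ∈ S.occ ↔ k = p ∨ k < 0 ∧ k ≠ h := fun k => Iff.rfl
  have h1 : completedCycle m (ket S) = ∑ᶠ k : ℤ, ((k : ℂ) + 1 / 2) ^ m • elem k k (ket S) := by
    simp [completedCycle, ket]
  have hne : p ≠ h := by lia
  rw [h1, finsum_eq_sum_of_support_subset (s := {p, h}), Finset.sum_pair hne,
    elem_self_ket (c := 1) (k := p), elem_self_ket (c := -1) (k := h), smul_smul, smul_smul,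
    ← add_smul]
  · congr 1; ring
  any_goals (intro h1 h2; first | rfl | (rw [hmem] at h2; lia))
  intro k hk
  by_contra hk'
  refine hk ?_
  simp only [Finset.coe_insert, Finset.coe_singleton, Set.mem_insert_iff,
    Set.mem_singleton_iff, not_or] at hk'
  beta_reduce
  rw [elem_self_ket (c := 0), zero_smul, smul_zero]
  all_goals (intro h1 h2; first | rfl | (rw [hmem] at h2; lia))

/-- The vector `∑ f(k) E_{k+m,k}` applied to the vacuum. -/
def hookSum (m : ℤ) (f : ℤ → ℂ) : Fock := ∑ k ∈ Finset.Ico (-m) 0, f k • hook (k + m) k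

theorem alpha_neg_vac {m : ℤ} (hm : 0 < m) : alpha (-m) vac = hookSum m fun _ => 1 := by
  rw [vac, alpha_ket (K := Finset.Ico (-m) 0) (by lia)]
  · refine Finset.sum_congr rfl fun k _ => ?_
    rw [elem_of_ne (by lia), one_smul, sub_neg_eq_add]
    rfl
  · intro k
    simp only [mem_vacuum, Finset.mem_Ico]
    lia

theorem completedCycle_hookSum (s : ℕ) (m : ℤ) (f : ℤ → ℂ) :
    completedCycle s (hookSum m f) = hookSum m fun k =>
      (((k + m : ℤ) + 1 / 2 : ℂ) ^ s - ((k : ℂ) + 1 / 2) ^ s) * f k := by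
  rw [hookSum, map_sum]
  refine Finset.sum_congr rfl fun k hk => ?_
  rw [Finset.mem_Ico] at hk
  rw [map_smul, completedCycle_hook s (by lia) hk.2, smul_smul, mul_comm]

theorem completedCycle_pow_hookSum (s : ℕ) (m : ℤ) (b : ℕ) (f : ℤ → ℂ) :
    (completedCycle s ^ b) (hookSum m f) = hookSum m fun k =>
      (((k + m : ℤ) + 1 / 2 : ℂ) ^ s - ((k : ℂ) + 1 / 2) ^ s) ^ b * f k := by
  induction b with
  | zero => simp
  | succ b ih =>
    rw [pow_succ', Module.End.mul_apply, ih, completedCycle_hookSum]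
    congr 1
    ext k
    ring

theorem alpha_hookSum_self {q : ℤ} (hq : 0 < q) (f : ℤ → ℂ) :
    alpha q (hookSum q f) = (∑ k ∈ Finset.Ico (-q) 0, f k) • vac := by
  rw [hookSum, map_sum, Finset.sum_smul]
  refine Finset.sum_congr rfl fun k hk => ?_
  rw [Finset.mem_Ico] at hk
  rw [map_smul, alpha_hook hq (by lia) hk.2, hook_of_nonneg _ (by lia : 0 ≤ k + q),
    add_sub_cancel_right, hook_self hk.2, sub_zero]

/-- Reindexing the hole moves by `q` turns `alpha_hook` into a backward difference of `f`; the
surplus terms at the ends of both ranges are degenerate hooks equal to zero. -/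
theorem alpha_hookSum {q m : ℤ} (hq : 0 < q) (hm : 0 < m) (f : ℤ → ℂ) :
    alpha q (hookSum (m + q) f) = hookSum m fun k => f k - f (k - q) := by
  have h1 : ∑ k ∈ Finset.Ico (-(m + q)) 0, f k • hook (k + m) k
      = ∑ k ∈ Finset.Ico (-m) 0, f k • hook (k + m) k := by
    refine (Finset.sum_subset (fun k => ?_) fun k h1 h2 => ?_).symm
    · simp only [Finset.mem_Ico]; lia
    · simp only [Finset.mem_Ico] at h1 h2
      rw [hook_of_neg (by lia) (by lia), smul_zero]
  have h2 : ∑ k ∈ Finset.Ico (-(m + q)) 0, f k • hook (k + (m + q)) (k + q)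
      = ∑ k ∈ Finset.Ico (-m) 0, f (k - q) • hook (k + m) k := by
    have hshift : ∑ k ∈ Finset.Ico (-(m + q)) 0, f k • hook (k + (m + q)) (k + q)
        = ∑ k ∈ Finset.Ico (-m) q, f (k - q) • hook (k + m) k := by
      refine Finset.sum_nbij' (· + q) (· - q) ?_ ?_ ?_ ?_ ?_ <;>
        intro k hk <;> simp only [Finset.mem_Ico] at hk ⊢
      · lia
      · lia
      · lia
      · lia
      · rw [add_sub_cancel_right, add_assoc k q m, add_comm q m]
    rw [hshift]
    refine (Finset.sum_subset (fun k => ?_) fun k h1 h2 => ?_).symm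
    · simp only [Finset.mem_Ico]; lia
    · simp only [Finset.mem_Ico] at h1 h2
      rw [hook_of_nonneg _ (by lia), smul_zero]
  simp only [hookSum, sub_smul, Finset.sum_sub_distrib, map_sum]
  rw [← h1, ← h2, ← Finset.sum_sub_distrib]
  refine Finset.sum_congr rfl fun k hk => ?_
  rw [Finset.mem_Ico] at hk
  rw [map_smul, alpha_hook hq (by lia) hk.2, smul_sub, ← add_assoc, add_sub_cancel_right]

theorem alpha_pow_hookSum {q : ℤ} (hq : 0 < q) (d : ℕ) (f : ℤ → ℂ) :
    (alpha q ^ (d + 1)) (hookSum (q * (d + 1)) f)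
      = (∑ k ∈ Finset.Ico (-q) 0, (fun (g : ℤ → ℂ) j => g j - g (j - q))^[d] f k) • vac := by
  induction d generalizing f with
  | zero => simpa using alpha_hookSum_self hq f
  | succ d ih =>
    have hd : q * ((d + 1 : ℕ) + 1 : ℤ) = q * (d + 1) + q := by push_cast; ring
    rw [pow_succ, Module.End.mul_apply, hd, alpha_hookSum hq (by positivity), ih,
      Function.iterate_succ_apply]

/-! ### One-part numbers by finite differences -/

-- One difference lowers the degree bound by one and multiplies the top coefficient by `q` times the
-- old bound. The bound need not be attained.
open Polynomial in
theorem iterate_sub_shift_eval (q : ℤ) (d : ℕ) (P : ℂ[X]) (hP : P.natDegree ≤ d) (k : ℤ) :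
    (fun (g : ℤ → ℂ) j => g j - g (j - q))^[d] (fun j => P.eval (j : ℂ)) k
      = d.factorial * (q : ℂ) ^ d * P.coeff d := by
  induction d generalizing P with
  | zero =>
    rw [eq_C_of_natDegree_le_zero hP]
    simp
  | succ d ih =>
    have hstep : (fun j : ℤ => P.eval (j : ℂ) - P.eval ((j - q : ℤ) : ℂ))
        = fun j : ℤ => (P - taylor (-(q : ℂ)) P).eval (j : ℂ) := by
      ext j
      simp [taylor_apply, sub_eq_add_neg]
    have hcoeff : ∀ n, d ≤ n → (taylor (-(q : ℂ)) P).coeff n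
        = P.coeff n + (n + 1) * P.coeff (n + 1) * (-(q : ℂ)) := by
      intro n hn
      have hdeg : (hasseDeriv n P).natDegree < 2 := by
        have := natDegree_hasseDeriv_le P n
        lia
      rw [taylor_coeff, eval_eq_sum_range' hdeg]
      simp [Finset.sum_range_succ, hasseDeriv_coeff, add_comm 1 n]
    rw [Function.iterate_succ_apply, hstep, ih]
    · rw [coeff_sub, hcoeff d le_rfl, Nat.factorial_succ]
      push_cast
      ring
    · rw [natDegree_le_iff_coeff_eq_zero]
      intro n hn
      rw [coeff_sub, hcoeff n hn.le, coeff_eq_zero_of_natDegree_lt (show P.natDegree < n + 1 by lia)]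
      ring

open Polynomial in
theorem vev_one_part {q r : ℕ} (hq : 1 ≤ q) (b : ℕ) :
    vev (alpha q ^ (r * b + 1) * completedCycle (r + 1) ^ b * alpha (-(q * (r * b + 1) : ℕ)))
      = q * ((r * b).factorial * (q : ℂ) ^ (r * b) *
          ((r + 1) * (q * (r * b + 1) : ℕ)) ^ b) := by
  have hq' : (0 : ℤ) < q := by lia
  set m : ℕ := q * (r * b + 1) with hm
  have hm0 : (0 : ℤ) < (m : ℕ) := by positivity
  have hmz : (m : ℤ) = (q : ℤ) * ((r * b : ℕ) + 1) := by rw [hm]; push_cast; ring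
  -- The eigenvalue as a polynomial in the hole position: the top powers cancel, leaving `(r + 1) m`
  -- in degree `r`.
  set Q : ℂ[X] := (X + C ((m : ℂ) + 1 / 2)) ^ (r + 1) - (X + C (1 / 2)) ^ (r + 1) with hQ
  have hQc : ∀ n, Q.coeff n = ((m : ℂ) + 1 / 2) ^ (r + 1 - n) * (r + 1).choose n
      - (1 / 2) ^ (r + 1 - n) * (r + 1).choose n := fun n => by
    rw [hQ, coeff_sub, coeff_X_add_C_pow, coeff_X_add_C_pow]
  have hQd : Q.natDegree ≤ r := by
    rw [natDegree_le_iff_coeff_eq_zero]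
    intro n hn
    rw [hQc, show r + 1 - n = 0 by lia]
    ring
  have hQr : Q.coeff r = (r + 1) * m := by
    rw [hQc, show r + 1 - r = 1 by lia, Nat.choose_succ_self_right]
    push_cast
    ring
  have hQb : (Q ^ b).natDegree ≤ r * b := by
    rw [mul_comm]; exact natDegree_pow_le_of_le b hQd
  have hlead : (Q ^ b).coeff (r * b) = ((r + 1) * m) ^ b := by
    rw [mul_comm r b, coeff_pow_of_natDegree_le hQd, hQr]
  have hf : (fun k : ℤ => (((k + (m : ℤ) : ℤ) + 1 / 2 : ℂ) ^ (r + 1) - ((k : ℂ) + 1 / 2) ^ (r + 1)) ^ b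
      * 1) = fun k : ℤ => (Q ^ b).eval (k : ℂ) := by
    ext k
    simp [hQ, add_assoc]
  have : (alpha q ^ (r * b + 1) * completedCycle (r + 1) ^ b * alpha (-(m : ℤ))) vac
      = (q * ((r * b).factorial * (q : ℂ) ^ (r * b) * ((r + 1) * m) ^ b)) • vac := by
    rw [Module.End.mul_apply, Module.End.mul_apply, alpha_neg_vac hm0,
      completedCycle_pow_hookSum, hf, hmz, alpha_pow_hookSum hq']
    congr 1
    rw [Finset.sum_congr rfl fun k _ => iterate_sub_shift_eval q (r * b) (Q ^ b) hQb k, hlead]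
    simp
  unfold vev
  change ((alpha q ^ (r * b + 1) * completedCycle (r + 1) ^ b * alpha (-(m : ℤ))) vac) vacuum = _
  rw [this]
  simp [vac, ket]

theorem disconnected_one_part {q r : ℕ} (hq : 1 ≤ q) (b : ℕ) :
    disconnected q r [q * (r * b + 1)] b
      = q * ((q * (r * b + 1) : ℕ) : ℂ) ^ b / ((q * (r * b + 1) : ℕ) : ℂ) ^ 2 := by
  have hdiv : q * (r * b + 1) / q = r * b + 1 := Nat.mul_div_cancel_left _ hq
  have hv := vev_one_part (r := r) hq b
  unfold disconnected
  rw [List.sum_singleton, if_pos ⟨_, rfl⟩, hdiv, List.map_singleton, List.prod_singleton]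
  simp only [smul_mul_assoc, mul_smul_comm]
  unfold vev at hv ⊢
  simp only [LinearMap.smul_apply, Finsupp.smul_apply, smul_eq_mul]
  rw [hv]
  have hq0 : (q : ℂ) ≠ 0 := by exact_mod_cast (by lia : q ≠ 0)
  have hr0 : (r + 1 : ℂ) ≠ 0 := by exact_mod_cast Nat.succ_ne_zero r
  have hf0 : ((r * b).factorial : ℂ) ≠ 0 := by exact_mod_cast Nat.factorial_ne_zero _
  have hd0 : ((r * b : ℕ) + 1 : ℂ) ≠ 0 := by exact_mod_cast (r * b).succ_ne_zero
  push_cast [Nat.factorial_succ] at hd0 ⊢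
  rw [mul_pow ((r : ℂ) + 1)]
  field_simp
  ring

/-! ### The coefficients of `y` -/

theorem connectedSeries_one_part (q r n : ℕ) :
    connectedSeries q r (fun _ : Fin 1 => n) = disconnectedSeries q r [n] := by
  have hatom : IsAtom (Finset.univ : Finset (Fin 1)) := by
    rw [Finset.isAtom_iff]
    exact ⟨0, rfl⟩
  have hparts : ∀ π : Finpartition (Finset.univ : Finset (Fin 1)), π.parts = {Finset.univ} := by
    intro π
    have h := (IsAtom.uniqueFinpartition (P := π) hatom).uniq π
    rw [h]
    rfl
  have hsub : Subsingleton (Finpartition (Finset.univ : Finset (Fin 1))) :=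
    ⟨fun a b => Finpartition.ext ((hparts a).trans (hparts b).symm)⟩
  unfold connectedSeries
  rw [Fintype.sum_subsingleton _ (Finpartition.indiscrete hatom.1), hparts]
  simp

theorem coeff_H01 (q r n : ℕ) (hn : 0 < n) :
    PowerSeries.coeff n (H01 q r) = connected q r 0 (fun _ : Fin 1 => n) /
      (⌊branchNumber q r 0 (fun _ : Fin 1 => n)⌋₊.factorial : ℂ) := by
  have hcard : ∀ _ : Fintype (Fin (Fintype.card Unit) ≃ Unit),
      (Finset.univ : Finset (Fin (Fintype.card Unit) ≃ Unit)).card = 1 := fun _ =>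
    Finset.card_univ.trans <| Fintype.card_eq_one_iff.2 ⟨finOneEquiv, fun _ => Equiv.ext fun _ => rfl⟩
  change correlator q r 0 Unit (Finsupp.single () n) = _
  unfold correlator
  simp only [Finsupp.single_apply, if_true, implies_true, hn]
  rw [Finset.sum_const, hcard]
  simp

theorem branchNumber_one_part {q r : ℕ} (hq : 1 ≤ q) (hr : 1 ≤ r) {n b : ℕ}
    (h : branchNumber q r 0 (fun _ : Fin 1 => n) = b) : n = q * (r * b + 1) := by
  have hq0 : (q : ℚ) ≠ 0 := by exact_mod_cast (by lia : q ≠ 0)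
  have hr0 : (r : ℚ) ≠ 0 := by exact_mod_cast (by lia : r ≠ 0)
  simp only [branchNumber, Fin.sum_univ_one] at h
  rw [div_eq_iff (mul_ne_zero hq0 hr0)] at h
  have : (n : ℚ) = q * (r * b + 1) := by push_cast at h; linarith
  exact_mod_cast this

theorem branchNumber_orbifold {q r : ℕ} (hq : 1 ≤ q) (hr : 1 ≤ r) (b : ℕ) :
    branchNumber q r 0 (fun _ : Fin 1 => q * (r * b + 1)) = b := by
  have hq0 : (q : ℚ) ≠ 0 := by exact_mod_cast (by lia : q ≠ 0)
  have hr0 : (r : ℚ) ≠ 0 := by exact_mod_cast (by lia : r ≠ 0)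
  simp only [branchNumber, Fin.sum_univ_one]
  rw [div_eq_iff (mul_ne_zero hq0 hr0)]
  push_cast
  ring

theorem coeff_y (q r n : ℕ) :
    PowerSeries.coeff n (y q r) = n * PowerSeries.coeff n (H01 q r) := by
  cases n with
  | zero => simp [y]
  | succ n =>
    rw [y, PowerSeries.coeff_succ_X_mul, PowerSeries.coeff_derivative]
    push_cast
    ring

theorem coeff_y_orbifold {q r : ℕ} (hq : 1 ≤ q) (hr : 1 ≤ r) (b : ℕ) :
    PowerSeries.coeff (q * (r * b + 1)) (y q r)
      = q * ((q * (r * b + 1) : ℕ) : ℂ) ^ b / (((q * (r * b + 1) : ℕ) : ℂ) * b.factorial) := by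
  have hn : 0 < q * (r * b + 1) := by positivity
  have hn0 : ((q * (r * b + 1) : ℕ) : ℂ) ≠ 0 := by exact_mod_cast hn.ne'
  have hb0 : (b.factorial : ℂ) ≠ 0 := by exact_mod_cast b.factorial_ne_zero
  rw [coeff_y, coeff_H01 q r _ hn, connected, branchNumber_orbifold hq hr, Nat.floor_natCast,
    if_pos rfl, connectedSeries_one_part, disconnectedSeries, PowerSeries.coeff_mk,
    disconnected_one_part hq]
  field_simp

theorem coeff_y_eq_zero {q r : ℕ} (hq : 1 ≤ q) (hr : 1 ≤ r) {n : ℕ}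
    (h : ∀ b, n ≠ q * (r * b + 1)) : PowerSeries.coeff n (y q r) = 0 := by
  rw [coeff_y]
  rcases n.eq_zero_or_pos with rfl | hn
  · simp
  rw [coeff_H01 q r _ hn, connected, if_neg fun h' => h _ (branchNumber_one_part hq hr h'.symm),
    zero_div, mul_zero]

/-! ### Formal inversion -/

open Polynomial in
theorem sum_choose_mul_affine_pow (a c : ℂ) (s : ℕ) :
    ∑ b ∈ Finset.range (s + 2),
      (-1 : ℂ) ^ (s + 1 - b) * (s + 1).choose b * (a + c * b) ^ s = 0 := by
  have hdeg : ((C c * X + C a) ^ s).natDegree < s + 1 :=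
    Nat.lt_succ_of_le ((natDegree_pow_le_of_le s natDegree_linear_le).trans (by simp))
  have h := congrFun (fwdDiff_iter_eq_zero_of_degree_lt hdeg) 0
  rw [fwdDiff_iter_eq_sum_shift] at h
  simpa [add_comm a] using h

/-- The `x^(q(rb+1))`-coefficient of `y(x)`. -/
def yCoeff (q r b : ℕ) : ℂ :=
  q * ((q * (r * b + 1) : ℕ) : ℂ) ^ b / (((q * (r * b + 1) : ℕ) : ℂ) * b.factorial)

/-- With `n = q + qrb` affine in `b`, each summand for `s > 0` is `q / s!` times a signed binomial
coefficient times `n^(s-1)`. -/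
theorem sum_yCoeff_mul {q : ℕ} (hq : 1 ≤ q) (r s : ℕ) :
    ∑ b ∈ Finset.range (s + 1), yCoeff q r b *
      ((-((q * (r * b + 1) : ℕ) : ℂ)) ^ (s - b) / (s - b).factorial)
      = if s = 0 then 1 else 0 := by
  have hn0 : ∀ b, ((q * (r * b + 1) : ℕ) : ℂ) ≠ 0 := fun b => by
    exact_mod_cast (by positivity : 0 < q * (r * b + 1)).ne'
  have hf0 : ∀ b : ℕ, (b.factorial : ℂ) ≠ 0 := fun b => by exact_mod_cast b.factorial_ne_zero
  cases s with
  | zero =>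
    have hq0 : (q : ℂ) ≠ 0 := by exact_mod_cast (by lia : q ≠ 0)
    simp [yCoeff, hq0]
  | succ s =>
    have h := sum_choose_mul_affine_pow q (q * r) s
    rw [if_neg s.succ_ne_zero, ← mul_zero ((q : ℂ) / (s + 1).factorial), ← h, Finset.mul_sum]
    refine Finset.sum_congr rfl fun b hb => ?_
    have hbs : b ≤ s + 1 := by simpa [Nat.lt_succ_iff] using hb
    have hcast : (q : ℂ) + q * r * b = ((q * (r * b + 1) : ℕ) : ℂ) := by push_cast; ring
    rw [hcast, Nat.cast_choose ℂ hbs, yCoeff, neg_pow]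
    have hpow : ((q * (r * b + 1) : ℕ) : ℂ) ^ b * ((q * (r * b + 1) : ℕ) : ℂ) ^ (s + 1 - b)
        = ((q * (r * b + 1) : ℕ) : ℂ) ^ s * ((q * (r * b + 1) : ℕ) : ℂ) := by
      rw [← pow_add, ← pow_succ]
      congr 1
      lia
    have h1 := hn0 b
    have h2 := hf0 b
    have h3 := hf0 (s + 1 - b)
    have h4 := hf0 (s + 1)
    generalize ((q * (r * b + 1) : ℕ) : ℂ) = n at *
    field_simp
    linear_combination (q : ℂ) * hpow

open PowerSeries

theorem rescale_exp_mul (a c : ℂ) :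
    rescale a (exp ℂ) * rescale c (exp ℂ) = rescale (a + c) (exp ℂ) :=
  exp_mul_exp_eq_exp_add a c

theorem rescale_exp_pow (a : ℂ) (k : ℕ) :
    rescale a (exp ℂ) ^ k = rescale (a * k) (exp ℂ) := by
  rw [← map_pow, exp_pow_eq_rescale_exp, rescale_rescale, mul_comm]

theorem coeff_mul_subst {V : ℂ⟦X⟧} (hV : constantCoeff V = 0) (F A : ℂ⟦X⟧) (s : ℕ) :
    coeff s (F * A.subst V) = ∑ b ∈ Finset.range (s + 1), coeff b A * coeff s (F * V ^ b) := by
  have hX : X ∣ V := X_dvd_iff.2 hV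
  have hsub : ∀ j ≤ s, coeff j (A.subst V)
      = ∑ b ∈ Finset.range (s + 1), coeff b A * coeff j (V ^ b) := by
    intro j hj
    rw [coeff_subst' (HasSubst.of_constantCoeff_zero' hV)]
    refine finsum_eq_sum_of_support_subset _ fun b hb => ?_
    by_contra hbs
    refine hb ?_
    have : coeff j (V ^ b) = 0 :=
      X_pow_dvd_iff.1 (pow_dvd_pow_of_dvd hX b) j (by simp at hbs; lia)
    beta_reduce
    rw [this, smul_zero]
  simp only [coeff_mul, Finset.mul_sum]
  rw [Finset.sum_comm]
  refine Finset.sum_congr rfl fun p hp => ?_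
  rw [hsub p.2 (by have := Finset.HasAntidiagonal.mem_antidiagonal.1 hp; lia), Finset.mul_sum]
  exact Finset.sum_congr rfl fun b _ => by ring

/-- This packs `sum_yCoeff_mul` over all `s` into one identity in `t = z^(qr)`. -/
theorem rescale_exp_mul_subst {q : ℕ} (hq : 1 ≤ q) (r : ℕ) :
    rescale (-(q : ℂ)) (exp ℂ) *
      (PowerSeries.mk (yCoeff q r)).subst (X * rescale (-(q * r : ℂ)) (exp ℂ)) = 1 := by
  ext s
  rw [coeff_mul_subst (by simp), coeff_one, ← sum_yCoeff_mul hq r s]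
  refine Finset.sum_congr rfl fun b hb => ?_
  have hbs : b ≤ s := by simpa [Nat.lt_succ_iff] using hb
  rw [mul_pow, rescale_exp_pow, mul_left_comm, rescale_exp_mul, coeff_mk, coeff_X_pow_mul', if_pos hbs,
    coeff_rescale, coeff_exp]
  congr 1
  have : (-(q : ℂ) + -(q * r : ℂ) * b) = -((q * (r * b + 1) : ℕ) : ℂ) := by push_cast; ring
  rw [this]
  simp [div_eq_mul_inv]

theorem y_eq {q r : ℕ} (hq : 1 ≤ q) (hr : 1 ≤ r) :
    y q r = X ^ q * (PowerSeries.mk (yCoeff q r)).subst (X ^ (q * r) : ℂ⟦X⟧) := by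
  have hN : q * r ≠ 0 := by positivity
  ext n
  rw [coeff_X_pow_mul', coeff_subst_X_pow hN]
  by_cases h : ∃ b, n = q * (r * b + 1)
  · obtain ⟨b, rfl⟩ := h
    have h1 : q * (r * b + 1) - q = q * r * b := by
      rw [mul_add, mul_one, Nat.add_sub_cancel, mul_assoc]
    rw [coeff_y_orbifold hq hr, if_pos (Nat.le_mul_of_pos_right q (by positivity)), h1,
      if_pos (dvd_mul_right _ _), Nat.mul_div_cancel_left _ (by positivity)]
    simp [yCoeff]
  · rw [coeff_y_eq_zero hq hr (by simpa using h)]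
    split_ifs with h1 h2
    · obtain ⟨b, hb⟩ := h2
      refine absurd ⟨b, ?_⟩ h
      rw [mul_add, mul_one, ← mul_assoc, ← hb]
      lia
    · rfl
    · rfl

/-- The expansion of `x(z) = z e^{-z^N}` at `z = 0`. -/
def xSeries (N : ℕ) : ℂ⟦X⟧ := X * (rescale (-1 : ℂ) (exp ℂ)).subst (X ^ N : ℂ⟦X⟧)

theorem constantCoeff_xSeries (N : ℕ) : constantCoeff (xSeries N) = 0 := by
  simp [xSeries]

theorem coeff_one_xSeries {N : ℕ} (hN : N ≠ 0) : coeff 1 (xSeries N) = 1 := by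
  rw [xSeries, show (1 : ℕ) = 0 + 1 from rfl, coeff_succ_X_mul, coeff_subst_X_pow hN]
  simp

theorem xSeries_pow {N : ℕ} (hN : N ≠ 0) (k : ℕ) :
    xSeries N ^ k = X ^ k * expand N hN (rescale (-(k : ℂ)) (exp ℂ)) := by
  rw [xSeries, mul_pow, ← expand_apply N hN, ← map_pow, rescale_exp_pow]
  simp

theorem y_subst_xSeries {q r : ℕ} (hq : 1 ≤ q) (hr : 1 ≤ r) :
    (y q r).subst (xSeries (q * r)) = X ^ q := by
  have hN : q * r ≠ 0 := by positivity
  have hW := HasSubst.of_constantCoeff_zero' (constantCoeff_xSeries (q * r))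
  have hV : HasSubst (X * rescale (-(q * r : ℂ)) (exp ℂ)) :=
    HasSubst.of_constantCoeff_zero' (by simp)
  have hWN : xSeries (q * r) ^ (q * r)
      = expand (q * r) hN (X * rescale (-(q * r : ℂ)) (exp ℂ)) := by
    rw [xSeries_pow hN, map_mul, expand_X]
    push_cast
    rfl
  have hsub : expand (q * r) hN
        ((PowerSeries.mk (yCoeff q r)).subst (X * rescale (-(q * r : ℂ)) (exp ℂ)))
      = (PowerSeries.mk (yCoeff q r)).subst
        (expand (q * r) hN (X * rescale (-(q * r : ℂ)) (exp ℂ))) := expand_subst _ hN hV _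
  rw [y_eq hq hr, subst_mul hW, subst_pow hW, subst_X hW,
    subst_comp_subst_apply (HasSubst.X_pow hN) hW, subst_pow hW, subst_X hW, hWN,
    ← hsub, xSeries_pow hN, mul_assoc, ← map_mul, rescale_exp_mul_subst hq,
    map_one, mul_one]

theorem eq_of_pow_eq_pow {q : ℕ} (hq : 1 ≤ q) {w z : ℂ⟦X⟧} (hw : constantCoeff w = 0)
    (hz : constantCoeff z = 0) (hw1 : coeff 1 w = 1) (hz1 : coeff 1 z = 1) (h : w ^ q = z ^ q) :
    w = z := by
  obtain ⟨u, rfl⟩ := X_dvd_iff.2 hw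
  obtain ⟨v, rfl⟩ := X_dvd_iff.2 hz
  rw [show (1 : ℕ) = 0 + 1 from rfl, coeff_succ_X_mul, coeff_zero_eq_constantCoeff_apply]
    at hw1 hz1
  rw [mul_pow, mul_pow] at h
  have huv : u ^ q = v ^ q := mul_left_cancel₀ (pow_ne_zero q X_ne_zero) h
  -- The cofactor of `u - v` in `u^q - v^q` has constant term `q`.
  have hne : ∑ i ∈ Finset.range q, u ^ i * v ^ (q - 1 - i) ≠ 0 := by
    intro h0
    have := congrArg (constantCoeff (R := ℂ)) h0
    simp [hw1, hz1] at this
    lia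
  have hprod := (Commute.all u v).geom_sum₂_mul q
  rw [huv, sub_self] at hprod
  rw [sub_eq_zero.1 ((mul_eq_zero.1 hprod).resolve_left hne)]

/-- The root is the compositional inverse `Z` of `x(z)`: substituting `Z` into `y(x(z)) = z^q` gives
`y = Z^q`, and `x(Z) = X` is the claimed equation. -/
theorem exists_root_y {q r : ℕ} (hq : 1 ≤ q) (hr : 1 ≤ r) :
    ∃ z : ℂ⟦X⟧, (coeff 1 z = 1 ∧ z ^ q = y q r) ∧
      (∀ w : ℂ⟦X⟧, coeff 1 w = 1 → w ^ q = y q r → w = z) ∧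
      X = z * (exp ℂ).subst (-(y q r) ^ r) := by
  have hN : q * r ≠ 0 := by positivity
  set W := xSeries (q * r) with hWdef
  have hW0 : constantCoeff W = 0 := constantCoeff_xSeries _
  have hW := HasSubst.of_constantCoeff_zero' hW0
  have hW1 : coeff 1 W = 1 := coeff_one_xSeries hN
  have hunit : IsUnit (coeff 1 W) := by rw [hW1]; exact isUnit_one
  set Z := W.substInvOfIsUnit hunit with hZdef
  have hZ0 : constantCoeff Z = 0 := constantCoeff_substInvOfIsUnit W hunit
  have hZ : HasSubst Z := HasSubst.of_constantCoeff_zero' hZ0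
  have hWZ : W.subst Z = X := subst_substInvOfIsUnit_right W hW0 hunit
  have hZ1 : coeff 1 Z = 1 := by
    rw [hZdef, coeff_one_substInvOfIsUnit]
    have : hunit.unit = 1 := Units.ext hW1
    simp [this]
  have hZq : Z ^ q = y q r := by
    have h := congrArg (subst Z) (y_subst_xSeries hq hr)
    rw [subst_comp_subst_apply hW hZ, hWZ, X_subst, subst_pow hZ, subst_X hZ] at h
    exact h.symm
  refine ⟨Z, ⟨hZ1, hZq⟩, fun w hw1 hwq => ?_, ?_⟩
  · refine eq_of_pow_eq_pow hq ?_ hZ0 hw1 hZ1 (hwq.trans hZq.symm)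
    have := congrArg (constantCoeff (R := ℂ)) (hwq.trans hZq.symm)
    rw [map_pow, map_pow, hZ0, zero_pow (by lia)] at this
    exact pow_eq_zero_iff (by lia) |>.1 this
  · have hneg : HasSubst ((-1 : ℂ) • X : ℂ⟦X⟧) := HasSubst.smul_X' _
    have hXN : HasSubst (X ^ (q * r) : ℂ⟦X⟧) := HasSubst.X_pow hN
    have hZN : HasSubst (Z ^ (q * r)) :=
      HasSubst.of_constantCoeff_zero' (by rw [map_pow, hZ0, zero_pow hN])
    rw [← hZq, ← pow_mul]
    conv_lhs => rw [← hWZ, hWdef, xSeries, subst_mul hZ, subst_X hZ, rescale_eq_subst,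
      subst_comp_subst_apply hXN hZ, subst_pow hZ, subst_X hZ,
      subst_comp_subst_apply hneg hZN, subst_smul hZN, subst_X hZN, neg_one_smul]

/-! ### Convergence on the spectral curve -/

theorem norm_yCoeff_le {q : ℕ} (hq : 1 ≤ q) (r b : ℕ) :
    ‖yCoeff q r b‖ ≤ Real.exp (q * (r * b + 1) : ℕ) := by
  rw [yCoeff, norm_div, norm_mul, norm_mul, norm_pow, Complex.norm_natCast, Complex.norm_natCast,
    Complex.norm_natCast]
  have hle : (q : ℝ) ≤ (q * (r * b + 1) : ℕ) := by
    exact_mod_cast Nat.le_mul_of_pos_right q (by positivity)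
  have hpos : (0 : ℝ) < (q * (r * b + 1) : ℕ) := by
    exact_mod_cast (by positivity : 0 < q * (r * b + 1))
  generalize ((q * (r * b + 1) : ℕ) : ℝ) = n at *
  have hb : (0 : ℝ) < b.factorial := by exact_mod_cast b.factorial_pos
  calc q * n ^ b / (n * b.factorial) ≤ n * n ^ b / (n * b.factorial) := by gcongr
    _ = n ^ b / b.factorial := by field_simp
    _ ≤ Real.exp n := Real.pow_div_factorial_le_exp n hpos.le b

/-- The monomials of `∑_b c_b x^(q(rb+1))` at `x = z e^{-z^(qr)}`, expanded in powers of `z`. -/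
def curveTerm (q r : ℕ) (z : ℂ) (p : ℕ × ℕ) : ℂ :=
  yCoeff q r p.1 * z ^ (q * (r * p.1 + 1)) *
    ((-((q * (r * p.1 + 1) : ℕ) : ℂ) * z ^ (q * r)) ^ p.2 / p.2.factorial)

theorem hasSum_curveTerm_snd (q r : ℕ) (z : ℂ) (b : ℕ) :
    HasSum (fun j => curveTerm q r z (b, j))
      (yCoeff q r b * (z * Complex.exp (-z ^ (q * r))) ^ (q * (r * b + 1))) := by
  have h := NormedSpace.expSeries_div_hasSum_exp
    (-((q * (r * b + 1) : ℕ) : ℂ) * z ^ (q * r))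
  rw [← Complex.exp_eq_exp_ℂ] at h
  have h2 := h.mul_left (yCoeff q r b * z ^ (q * (r * b + 1)))
  have hexp : yCoeff q r b * (z * Complex.exp (-z ^ (q * r))) ^ (q * (r * b + 1))
      = yCoeff q r b * z ^ (q * (r * b + 1)) *
        Complex.exp (-((q * (r * b + 1) : ℕ) : ℂ) * z ^ (q * r)) := by
    rw [mul_pow, ← Complex.exp_nat_mul, mul_assoc]
    congr 3
    ring
  rw [hexp]
  exact h2

theorem summable_curveTerm {q r : ℕ} (hq : 1 ≤ q) (hr : 1 ≤ r) {z : ℂ}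
    (hz : ‖z‖ < Real.exp (-2)) : Summable (curveTerm q r z) := by
  have hz1 : ‖z‖ ≤ 1 := hz.le.trans (Real.exp_le_one_iff.2 (by norm_num))
  have hsnd : ∀ b, HasSum (fun j => ‖curveTerm q r z (b, j)‖)
      (‖yCoeff q r b‖ * ‖z‖ ^ (q * (r * b + 1)) *
        Real.exp ((q * (r * b + 1) : ℕ) * ‖z‖ ^ (q * r))) := by
    intro b
    have h := NormedSpace.expSeries_div_hasSum_exp
      (((q * (r * b + 1) : ℕ) : ℝ) * ‖z‖ ^ (q * r))
    rw [← Real.exp_eq_exp_ℝ] at h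
    have h2 := h.mul_left (‖yCoeff q r b‖ * ‖z‖ ^ (q * (r * b + 1)))
    simpa only [curveTerm, norm_mul, norm_div, norm_pow, norm_neg, Complex.norm_natCast] using h2
  refine Summable.of_norm ((summable_prod_of_nonneg fun _ => norm_nonneg _).2
    ⟨fun b => (hsnd b).summable, ?_⟩)
  -- With `n = q(rb+1)`, the coefficient and the exponential each cost at most `e^n`, so row `b` is
  -- at most `ρ^n`; this fixes the radius `e^{-2}`.
  set ρ := Real.exp 2 * ‖z‖ with hρ
  have hρ0 : 0 ≤ ρ := by positivity
  have hρ1 : ρ < 1 := by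
    calc ρ < Real.exp 2 * Real.exp (-2) := by rw [hρ]; gcongr
      _ = 1 := by rw [← Real.exp_add]; simp
  refine Summable.of_nonneg_of_le (fun b => tsum_nonneg fun _ => norm_nonneg _) (fun b => ?_)
    (summable_geometric_of_lt_one hρ0 hρ1)
  rw [(hsnd b).tsum_eq]
  have hb : b ≤ q * (r * b + 1) := by nlinarith [Nat.le_mul_of_pos_left b hr, Nat.le_mul_of_pos_left (r * b + 1) hq]
  refine le_trans ?_ (pow_le_pow_of_le_one hρ0 hρ1.le hb)
  have h1 := norm_yCoeff_le hq r b
  have h2 : Real.exp ((q * (r * b + 1) : ℕ) * ‖z‖ ^ (q * r)) ≤ Real.exp (q * (r * b + 1) : ℕ) :=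
    Real.exp_le_exp.2 (mul_le_of_le_one_right (by positivity) (pow_le_one₀ (norm_nonneg z) hz1))
  generalize q * (r * b + 1) = n at *
  calc _ ≤ Real.exp n * ‖z‖ ^ n * Real.exp n := by gcongr
    _ = ρ ^ n := by
      rw [hρ, mul_pow, ← Real.exp_nat_mul, mul_comm (n : ℝ) 2, two_mul, Real.exp_add]
      ring

theorem sum_antidiagonal_curveTerm {q : ℕ} (hq : 1 ≤ q) (r : ℕ) (z : ℂ) (s : ℕ) :
    ∑ p ∈ Finset.HasAntidiagonal.antidiagonal s, curveTerm q r z p = if s = 0 then z ^ q else 0 := by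
  have h := congrArg (z ^ (q * (r * s + 1)) * ·) (sum_yCoeff_mul hq r s)
  beta_reduce at h
  rw [Finset.Nat.sum_antidiagonal_eq_sum_range_succ_mk]
  refine Eq.trans ?_ (h.trans ?_)
  · rw [Finset.mul_sum]
    refine Finset.sum_congr rfl fun b hb => ?_
    obtain ⟨j, rfl⟩ := Nat.exists_eq_add_of_le (Nat.lt_succ_iff.1 (Finset.mem_range.1 hb))
    rw [Nat.add_sub_cancel_left, curveTerm, mul_pow, ← pow_mul]
    rw [show q * (r * (b + j) + 1) = q * (r * b + 1) + q * r * j by ring, pow_add]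
    ring
  · split_ifs with hs
    · simp [hs]
    · simp

/-- The double series is summed in two ways: rows give `y` at `x(z)`, and of the antidiagonals only
`s = 0` survives, giving `z^q`. -/
theorem hasSum_y {q r : ℕ} (hq : 1 ≤ q) (hr : 1 ≤ r) {z : ℂ} (hz : ‖z‖ < Real.exp (-2)) :
    HasSum (fun n : ℕ => coeff n (y q r) * (z * Complex.exp (-z ^ (q * r))) ^ n) (z ^ q) := by
  have hsum := (summable_curveTerm hq hr hz).hasSum
  have hdiag := ((Finset.HasAntidiagonal.sigmaAntidiagonalEquivProd (A := ℕ)).hasSum_iff.2 hsum).sigma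
    fun s => hasSum_fintype _
  have hval : ∑' p, curveTerm q r z p = z ^ q := by
    refine hdiag.unique ?_
    convert hasSum_ite_eq 0 (z ^ q) using 2 with s
    rw [← sum_antidiagonal_curveTerm hq r z s]
    exact Finset.sum_coe_sort (Finset.HasAntidiagonal.antidiagonal s) (curveTerm q r z)
  have hfst := hsum.prod_fiberwise fun b => hasSum_curveTerm_snd q r z b
  rw [hval] at hfst
  have hinj : Function.Injective fun b => q * (r * b + 1) := by
    intro b c h
    have h1 := Nat.eq_of_mul_eq_mul_left (by lia : 0 < q) h
    exact Nat.eq_of_mul_eq_mul_left (by lia : 0 < r) (by lia)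
  rw [← hinj.hasSum_iff]
  · convert hfst using 2 with b
    simp only [Function.comp_apply]
    rw [coeff_y_orbifold hq hr, yCoeff]
  · intro n hn
    rw [coeff_y_eq_zero hq hr fun b hb => hn ⟨b, hb.symm⟩, zero_mul]

end SpinHurwitz

end

theorem lemma3p2 (q r : ℕ) (hq : 1 ≤ q) (hr : 1 ≤ r) :
    (∃ z : PowerSeries ℂ,
      (PowerSeries.coeff 1 z = 1 ∧ z ^ q = SpinHurwitz.y q r) ∧
      (∀ w : PowerSeries ℂ, PowerSeries.coeff 1 w = 1 → w ^ q = SpinHurwitz.y q r → w = z) ∧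
      PowerSeries.X = z * (PowerSeries.exp ℂ).subst (-(SpinHurwitz.y q r) ^ r)) ∧
    (∃ δ : ℝ, 0 < δ ∧ ∀ z : ℂ, ‖z‖ < δ →
      HasSum (fun n : ℕ => PowerSeries.coeff n (SpinHurwitz.y q r) *
        (z * Complex.exp (-z ^ (q * r))) ^ n) (z ^ q)) :=
  ⟨SpinHurwitz.exists_root_y hq hr,
    Real.exp (-2), Real.exp_pos _, fun _ hz => SpinHurwitz.hasSum_y hq hr hz⟩
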